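/- Let $d\ge 1$, let $\Omega\subset\mathbb R^d$ be a non-empty bounded open set, and impose either homogeneous Dirichlet, or homogeneous Neumann, or periodic boundary conditions (in the periodic case $\Omega$ is a box $\prod_i(a_i,b_i)$). Let $V$ be $H^1_0(\Omega)$, $H^1(\Omega)$, or the closure of the smooth periodic functions in $H^1(\Omega)$, respectively. We say that $w\in L^2(\Omega)$ is the Laplacian $\Delta v$ of $v\in V$ (under the boundary condition) if $\int_\Omega\nabla v\cdot\nabla\varphi\,dx=-\int_\Omega w\,\varphi\,dx$ for all $\varphi\in V$. Write $\|\cdot\|$ for the norm of $L^2(\Omega)$. Let $\alpha\in(0,1)$, $\gamma>0$, $\varepsilon>0$, $T>0$, $N\ge1$, $\Delta t=T/N$, $F(s)=\frac14(s^2-1)^2$, $f(s)=F'(s)=s^3-s$, and $$b_k=\frac{(k+1)^{1-\alpha}-k^{1-\alpha}}{\Gamma(2-\alpha)\,\Delta t^{\alpha}},\qquad \overline\partial_t^\alpha u^n=\sum_{k=1}^n b_{n-k}(u^k-u^{k-1}).$$ Let $u^0,\dots,u^N\in V$ solve the stabilized semidiscrete L1 implicit–explicit scheme for the time-fractional Allen–Cahn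 equation $\partial_t^\alpha u=\gamma(\varepsilon^2\Delta u-f(u))$: for $1\le n\le N$, $u^n$ has a Laplacian $\Delta u^n\in L^2(\Omega)$ in the above sense and $$\overline\partial_t^\alpha u^n=\gamma\left(\varepsilon^2\Delta u^n-f(u^{n-1})-S(u^n-u^{n-1})\right)\quad\text{a.e. in }\Omega .$$ Let $$E(v)=\int_\Omega\Big(\frac{\varepsilon^2}{2}|\nabla v|^2+F(v)\Big)dx,$$ $$\tilde E(u^n)=E(u^n)+\frac1{2\gamma}\sum_{k=1}^{n-1}(b_{n-k-1}-b_{n-k})\|u^n-u^k\|^2+\frac1{2\gamma}\,b_{n-1}\|u^n-u^0\|^2\quad(n\ge1),\qquad \tilde E(u^0)=E(u^0).$$ **Theorem.** If $S\ge2$ and $\|u^0\|_{L^\infty(\Omega)}\le1$, then, with no restriction on the time step $\Delta t$, the energies $E(u^n)$, $0\le n\le N$, are finite, the scheme is energy stable, i.e. $E(u^n)\le E(u^0)$ for all $0\le n\le N$, and it satisfies the modified energy dissipation law $$\tilde E(u^n)\le\tilde E(u^{n-1})\qquad\text{for all }1\le n\le N.$$ -/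

import Mathlib

open MeasureTheory Filter Topology

noncomputable section

namespace TFAC

/-- Euclidean space of dimension `d`. -/
abbrev E (d : ℕ) := EuclideanSpace ℝ (Fin d)

/-- The double well potential. -/
def F (s : ℝ) : ℝ := (s ^ 2 - 1) ^ 2 / 4

/-- The derivative of the double well potential. -/
def f (s : ℝ) : ℝ := s ^ 3 - s

/-! ### Sobolev spaces -/

/-- Smooth functions with compact support in the open set `Ω`. -/
def IsTestFunction {d : ℕ} (Ω : Set (E d)) (φ : E d → ℝ) : Prop :=
  ContDiff ℝ (⊤ : ℕ∞) φ ∧ HasCompactSupport φ ∧ tsupport φ ⊆ Ω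

/-- Smooth functions on the whole space that have period `b i - a i` in the `i`-th coordinate. -/
def IsSmoothPeriodic {d : ℕ} (a b : Fin d → ℝ) (φ : E d → ℝ) : Prop :=
  ContDiff ℝ (⊤ : ℕ∞) φ ∧
    ∀ (x : E d) (i : Fin d), φ (x + EuclideanSpace.single i (b i - a i)) = φ x

/-- `u ∈ H¹(Ω)` with weak gradient `G` (which `u` determines almost everywhere in `Ω`). -/
structure IsH1 {d : ℕ} (Ω : Set (E d)) (u : E d → ℝ) (G : E d → E d) : Prop where
  memLp : MemLp u 2 (volume.restrict Ω)
  memLp_grad : MemLp G 2 (volume.restrict Ω)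
  weak : ∀ φ : E d → ℝ, IsTestFunction Ω φ →
    ∫ x in Ω, u x • gradient φ x = -∫ x in Ω, φ x • G x

/-- The function `u`, with gradient `G`, is a limit in the norm of `H¹(Ω)` of smooth functions
from the class `C`. -/
def IsH1LimitOf {d : ℕ} (Ω : Set (E d)) (C : (E d → ℝ) → Prop)
    (u : E d → ℝ) (G : E d → E d) : Prop :=
  ∃ φ : ℕ → E d → ℝ, (∀ k, C (φ k)) ∧
    Tendsto (fun k => eLpNorm (fun x => φ k x - u x) 2 (volume.restrict Ω)) atTop (𝓝 0) ∧
    Tendsto (fun k => eLpNorm (fun x => gradient (φ k) x - G x) 2 (volume.restrict Ω))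
      atTop (𝓝 0)

/-! ### Boundary conditions -/

/-- Homogeneous Dirichlet, homogeneous Neumann, or periodic boundary conditions (the latter on the
box with lower corner `a` and upper corner `b`). -/
inductive BoundaryCondition (d : ℕ) where
  | dirichlet : BoundaryCondition d
  | neumann : BoundaryCondition d
  | periodic (a b : Fin d → ℝ) : BoundaryCondition d

/-- Periodic boundary conditions are imposed on a box only; there is no restriction for the other
two boundary conditions. -/
def BoundaryCondition.IsCompatible {d : ℕ} (Ω : Set (E d)) : BoundaryCondition d → Prop
  | .dirichlet => True
  | .neumann => True
  | .periodic a b => (∀ i, a i < b i) ∧ Ω = {x | ∀ i, a i < x i ∧ x i < b i}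

/-- The space `H¹₀(Ω)` (closure of the test functions in `H¹(Ω)`), `H¹(Ω)`, or `H¹` of the torus
(closure of the smooth periodic functions in `H¹(Ω)`), respectively; a member `u` is listed with
its weak gradient `G`. -/
def BoundaryCondition.Space {d : ℕ} (Ω : Set (E d)) (u : E d → ℝ) (G : E d → E d) :
    BoundaryCondition d → Prop
  | .dirichlet => IsH1 Ω u G ∧ IsH1LimitOf Ω (IsTestFunction Ω) u G
  | .neumann => IsH1 Ω u G
  | .periodic a b => IsH1 Ω u G ∧ IsH1LimitOf Ω (IsSmoothPeriodic a b) u G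

/-- `w ∈ L²(Ω)` is the Laplacian of a function with weak gradient `G`, under the given boundary
condition: Green's formula `∫ ∇u · ∇φ = -∫ w φ` holds for every `φ` in the space that belongs to the
boundary condition. For the Neumann condition this includes the vanishing of the normal derivative
on the boundary. -/
structure IsLaplacian {d : ℕ} (Ω : Set (E d)) (bc : BoundaryCondition d)
    (G : E d → E d) (w : E d → ℝ) : Prop where
  memLp : MemLp w 2 (volume.restrict Ω)
  green : ∀ (φ : E d → ℝ) (Φ : E d → E d), bc.Space Ω φ Φ →
    ∫ x in Ω, inner ℝ (G x) (Φ x) = -∫ x in Ω, w x * φ x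

/-! ### The scheme -/

/-- The coefficients `b_k` of the L1 approximation with time step `τ`. -/
def coeff (α τ : ℝ) (k : ℕ) : ℝ :=
  1 / (Real.Gamma (2 - α) * τ ^ α) * (((k : ℝ) + 1) ^ (1 - α) - (k : ℝ) ^ (1 - α))

/-- The L1 approximation of the Caputo derivative of order `α` at the `n`-th time level. -/
def discreteCaputo (α τ : ℝ) (v : ℕ → ℝ) (n : ℕ) : ℝ :=
  ∑ k ∈ Finset.Icc 1 n, coeff α τ (n - k) * (v k - v (k - 1))

/-- `u 0, …, u N`, with weak gradients `G 0, …, G N`, is a solution of the stabilized semidiscrete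
L1 implicit-explicit scheme on `Ω`. -/
structure IsSolution {d : ℕ} (Ω : Set (E d)) (bc : BoundaryCondition d) (α γ ε S τ : ℝ) (N : ℕ)
    (u : ℕ → E d → ℝ) (G : ℕ → E d → E d) : Prop where
  space : ∀ n ≤ N, bc.Space Ω (u n) (G n)
  scheme : ∀ n, 1 ≤ n → n ≤ N → ∃ w : E d → ℝ, IsLaplacian Ω bc (G n) w ∧
    ∀ᵐ x ∂(volume.restrict Ω),
      discreteCaputo α τ (fun k => u k x) n
        = γ * (ε ^ 2 * w x - f (u (n - 1) x) - S * (u n x - u (n - 1) x))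

/-! ### Energies -/

/-- The density of the Ginzburg-Landau energy. -/
def energyDensity {d : ℕ} (ε : ℝ) (u : E d → ℝ) (G : E d → E d) (x : E d) : ℝ :=
  ε ^ 2 / 2 * ‖G x‖ ^ 2 + F (u x)

/-- The Ginzburg-Landau energy of a function `u` with weak gradient `G`. -/
def energy {d : ℕ} (Ω : Set (E d)) (ε : ℝ) (u : E d → ℝ) (G : E d → E d) : ℝ :=
  ∫ x in Ω, energyDensity ε u G x

/-- The squared norm of `v` in `L²(Ω)`. -/
def normSq {d : ℕ} (Ω : Set (E d)) (v : E d → ℝ) : ℝ := ∫ x in Ω, v x ^ 2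

/-- The discrete modified energy at the `n`-th time level; for `n = 0` it is the energy of `u 0`. -/
def modifiedEnergy {d : ℕ} (Ω : Set (E d)) (α γ ε τ : ℝ)
    (u : ℕ → E d → ℝ) (G : ℕ → E d → E d) (n : ℕ) : ℝ :=
  energy Ω ε (u n) (G n)
    + 1 / (2 * γ) * ∑ k ∈ Finset.Icc 1 (n - 1),
        (coeff α τ (n - k - 1) - coeff α τ (n - k)) * normSq Ω (fun x => u n x - u k x)
    + 1 / (2 * γ) * coeff α τ (n - 1) * normSq Ω (fun x => u n x - u 0 x)

end TFAC

end

/-! The argument rests on a maximum principle and a discrete fractional chain rule.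

Maximum principle: `|u n| ≤ 1` a.e. for every `n`. Summation by parts writes the L1 derivative as a
combination of the differences `u n - u k`, `k < n`, with nonnegative weights. Hence, where `u n >
1` and all earlier values are at most `1`, it is nonnegative, and the scheme bounds `ε² Δu` below by
`f s + S (t - s)` with `s = u (n-1)`, `t = u n`, which is positive because `S ≥ 2`. Green's formula
tested with `η (u n)`, for `η` nondecreasing and zero exactly on `(-∞, 1]`, gives `∫ Δu η(u) = -∫
η'(u) |∇u|² ≤ 0`, so the set `u n > 1` is null. The bound from below is symmetric. That `η (u n)` is
admissible is the chain rule in `H¹`, proved by mollification (`IsH1.comp`) and compatible with the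
closures that encode the boundary conditions (`IsH1LimitOf.comp`).

Dissipation: the L1 weights are positive, decreasing and convex in the index, so the increment of
the history term is at most `2 D (u n - u (n-1))`, `D` being the discrete derivative
(`history_succ_sub_le`). On `[-1, 1]` one has `F'' ≤ 2`, so treating `f` explicitly costs at most
`(u n - u (n-1))²` (`F_sub_le`), which the stabilization absorbs; Green's formula cancels the
gradient part against the Laplacian. Energy stability follows because the history term is
nonnegative and vanishes at `n = 0`. -/

namespace TFAC

/-! ### Mollification of integrable functions and of weak gradients -/

section

open scoped Convolution
open ContinuousLinearMap (lsmul)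

variable {d : ℕ}

/-- A sequence of bump functions whose supports shrink to the origin. -/
noncomputable def bumpSeq (d k : ℕ) : ContDiffBump (0 : E d) where
  rIn := 1 / ((k : ℝ) + 1)
  rOut := 2 / ((k : ℝ) + 1)
  rIn_pos := by positivity
  rIn_lt_rOut := by gcongr; norm_num

theorem tendsto_bumpSeq_rOut : Tendsto (fun k => (bumpSeq d k).rOut) atTop (𝓝 0) := by
  have := (tendsto_one_div_add_atTop_nhds_zero_nat (𝕜 := ℝ)).const_mul 2
  simpa [bumpSeq, div_eq_mul_inv] using this

/-- The mollification of `g` with the `k`-th bump function. -/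
noncomputable def mollify {V : Type*} [NormedAddCommGroup V] [NormedSpace ℝ V]
    (k : ℕ) (g : E d → V) : E d → V :=
  (bumpSeq d k).normed volume ⋆[lsmul ℝ ℝ, volume] g

theorem ae_tendsto_mollify {V : Type*} [NormedAddCommGroup V] [NormedSpace ℝ V]
    [CompleteSpace V] {g : E d → V} (hg : LocallyIntegrable g) :
    ∀ᵐ x, Tendsto (fun k => mollify k g x) atTop (𝓝 (g x)) :=
  ContDiffBump.ae_convolution_tendsto_right_of_locallyIntegrable (K := 2) tendsto_bumpSeq_rOut
    (Eventually.of_forall fun k => by simp [bumpSeq, div_eq_mul_inv]) hg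

theorem integrable_mollify {V : Type*} [NormedAddCommGroup V] [NormedSpace ℝ V]
    {g : E d → V} (hg : Integrable g) (k : ℕ) : Integrable (mollify k g) :=
  (bumpSeq d k).integrable_normed.integrable_convolution (lsmul ℝ ℝ) hg

theorem integral_mollify {V : Type*} [NormedAddCommGroup V] [NormedSpace ℝ V]
    [CompleteSpace V] {g : E d → V} (hg : Integrable g) (k : ℕ) :
    ∫ x, mollify k g x = ∫ x, g x := by
  unfold mollify
  rw [integral_convolution _ (bumpSeq d k).integrable_normed hg]
  simp [ContDiffBump.integral_normed]

theorem norm_mollify_le {V : Type*} [NormedAddCommGroup V] [NormedSpace ℝ V]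
    (g : E d → V) (k : ℕ) (x : E d) :
    ‖mollify k g x‖ ≤ mollify k (fun y => ‖g y‖) x := by
  unfold mollify convolution
  refine (norm_integral_le_integral_norm _).trans_eq (integral_congr_ae (.of_forall fun t => ?_))
  simp [norm_smul, abs_of_nonneg ((bumpSeq d k).nonneg_normed (μ := volume) t)]

/-- Mollifications of an integrable function converge in `L¹`. -/
theorem tendsto_integral_norm_mollify_sub {V : Type*} [NormedAddCommGroup V] [NormedSpace ℝ V]
    [CompleteSpace V] {g : E d → V} (hg : Integrable g) :
    Tendsto (fun k => ∫ x, ‖mollify k g x - g x‖) atTop (𝓝 0) := by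
  have hM := fun k => integrable_mollify hg.norm k
  have hgk := fun k => (integrable_mollify hg k).sub hg
  -- A Scheffé-type argument: a.e. convergence and preservation of the integral of `‖g‖` under
  -- mollification. Truncating at `2 * ‖g‖` gives a dominated sequence; the excess is controlled by
  -- the mollified norm minus `‖g‖`, whose integral is zero.
  have h1 : Tendsto (fun k => ∫ x, min ‖mollify k g x - g x‖ (2 * ‖g x‖)) atTop (𝓝 0) := by
    have := tendsto_integral_of_dominated_convergence (μ := volume)
      (F := fun k x => min ‖mollify k g x - g x‖ (2 * ‖g x‖)) (f := fun _ => (0 : ℝ))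
      (fun x => 2 * ‖g x‖) (fun k => ((hgk k).norm.inf (hg.norm.const_mul 2)).1)
      (hg.norm.const_mul 2) (fun k => .of_forall fun x => by
        rw [Real.norm_of_nonneg (by positivity)]; exact min_le_right _ _) (by
        filter_upwards [ae_tendsto_mollify hg.locallyIntegrable] with x hx
        have h := ((hx.sub_const (g x)).norm).min (tendsto_const_nhds (x := 2 * ‖g x‖))
        simpa using h)
    simpa using this
  have h2 : Tendsto (fun k => ∫ x, max (‖g x‖ - mollify k (fun y => ‖g y‖) x) 0) atTop (𝓝 0) := by
    have := tendsto_integral_of_dominated_convergence (μ := volume)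
      (F := fun k x => max (‖g x‖ - mollify k (fun y => ‖g y‖) x) 0) (f := fun _ => (0 : ℝ))
      (fun x => ‖g x‖) (fun k => ((hg.norm.sub (hM k)).pos_part).1)
      hg.norm (fun k => .of_forall fun x => by
        rw [Real.norm_of_nonneg (le_max_right _ _)]
        have := (norm_nonneg _).trans (norm_mollify_le g k x)
        exact max_le (by linarith) (norm_nonneg _)) (by
        filter_upwards [ae_tendsto_mollify hg.norm.locallyIntegrable] with x hx
        have h := (hx.const_sub (‖g x‖)).max (tendsto_const_nhds (x := (0 : ℝ)))
        simpa using h)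
    simpa using this
  refine squeeze_zero (fun k => integral_nonneg fun x => norm_nonneg _) (fun k => ?_)
    (by simpa using h1.add h2)
  have i1 : Integrable fun x => min ‖mollify k g x - g x‖ (2 * ‖g x‖) :=
    (hgk k).norm.inf (hg.norm.const_mul 2)
  have i2 : Integrable fun x => max (‖g x‖ - mollify k (fun y => ‖g y‖) x) 0 :=
    (hg.norm.sub (hM k)).pos_part
  have i3 : Integrable fun x => mollify k (fun y => ‖g y‖) x - ‖g x‖ := (hM k).sub hg.norm
  have h0 : ∫ x, (mollify k (fun y => ‖g y‖) x - ‖g x‖) = 0 := by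
    rw [integral_sub (hM k) hg.norm, integral_mollify hg.norm, sub_self]
  calc ∫ x, ‖mollify k g x - g x‖
      ≤ ∫ x, (min ‖mollify k g x - g x‖ (2 * ‖g x‖)
          + max (‖g x‖ - mollify k (fun y => ‖g y‖) x) 0
          + (mollify k (fun y => ‖g y‖) x - ‖g x‖)) := by
        refine integral_mono (hgk k).norm ((i1.add i2).add i3) fun x => ?_
        have a1 := norm_mollify_le g k x
        have a2 := norm_sub_le (mollify k g x) (g x)
        have a3 := le_max_left (‖g x‖ - mollify k (fun y => ‖g y‖) x) 0
        have a4 := le_max_right (‖g x‖ - mollify k (fun y => ‖g y‖) x) 0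
        rcases min_cases ‖mollify k g x - g x‖ (2 * ‖g x‖) with ⟨h, _⟩ | ⟨h, _⟩ <;>
          rw [h] <;> linarith
    _ = _ := by
        rw [integral_add (by exact i1.add i2) i3, integral_add i1 i2, h0, add_zero]

theorem contDiff_mollify {g : E d → ℝ} (hg : LocallyIntegrable g) (k : ℕ) :
    ContDiff ℝ (⊤ : ℕ∞) (mollify k g) :=
  (bumpSeq d k).hasCompactSupport_normed.contDiff_convolution_left _
    (bumpSeq d k).contDiff_normed hg

/-- Integration by parts against a test function. -/
theorem integral_smul_gradient_eq_neg {v φ : E d → ℝ} (hv : ContDiff ℝ 1 v)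
    (hφ : ContDiff ℝ 1 φ) (hc : HasCompactSupport φ) :
    ∫ x, v x • gradient φ x = -∫ x, φ x • gradient v x := by
  have gv : Continuous (gradient v) :=
    (InnerProductSpace.toDual ℝ (E d)).symm.continuous.comp (hv.continuous_fderiv one_ne_zero)
  have gφ : Continuous (gradient φ) :=
    (InnerProductSpace.toDual ℝ (E d)).symm.continuous.comp (hφ.continuous_fderiv one_ne_zero)
  have cφ : HasCompactSupport (gradient φ) :=
    (hc.fderiv ℝ).comp_left (g := (InnerProductSpace.toDual ℝ (E d)).symm) (map_zero _)
  have i1 : Integrable fun x => v x • gradient φ x :=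
    (hv.continuous.smul gφ).integrable_of_hasCompactSupport cφ.smul_left
  have i2 : Integrable fun x => φ x • gradient v x :=
    (hφ.continuous.smul gv).integrable_of_hasCompactSupport hc.smul_right
  refine ext_inner_right ℝ fun w => ?_
  rw [inner_neg_left, real_inner_comm, real_inner_comm w, ← integral_inner i1, ← integral_inner i2]
  have e1 : ∀ x, inner ℝ w (v x • gradient φ x) = v x * fderiv ℝ φ x w := fun x => by
    rw [inner_smul_right, real_inner_comm, inner_gradient_left]
  have e2 : ∀ x, inner ℝ w (φ x • gradient v x) = fderiv ℝ v x w * φ x := fun x => by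
    rw [inner_smul_right, real_inner_comm, inner_gradient_left, mul_comm]
  simp_rw [e1, e2]
  refine integral_mul_fderiv_eq_neg_fderiv_mul_of_integrable ?_ ?_ ?_
    (fun x _ => hv.differentiable one_ne_zero x) (fun x _ => hφ.differentiable one_ne_zero x)
  · exact (i2.const_inner (𝕜 := ℝ) w).congr (.of_forall e2)
  · exact (i1.const_inner (𝕜 := ℝ) w).congr (.of_forall e1)
  · exact (hv.continuous.mul hφ.continuous).integrable_of_hasCompactSupport hc.mul_left

/-- The gradient of a mollification, away from the boundary. -/
theorem gradient_mollify {Ω : Set (E d)} (hΩ : IsOpen Ω) {u : E d → ℝ} {G : E d → E d}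
    (h : IsH1 Ω u G) (hu : LocallyIntegrable (Ω.indicator u)) {k : ℕ} {x : E d}
    (hx : Metric.closedBall x (bumpSeq d k).rOut ⊆ Ω) :
    gradient (mollify k (Ω.indicator u)) x = mollify k (Ω.indicator G) x := by
  set ρ := (bumpSeq d k).normed (volume : Measure (E d)) with hρ
  have ρs : ContDiff ℝ (⊤ : ℕ∞) ρ := (bumpSeq d k).contDiff_normed
  have ρc : HasCompactSupport ρ := (bumpSeq d k).hasCompactSupport_normed
  -- The reflected translate of the bump is supported in the closed ball about `x`, hence in `Ω`, so
  -- the weak formulation may be tested with it.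
  have ht : IsTestFunction Ω (fun t => ρ (x - t)) := by
    refine ⟨ρs.comp (contDiff_const.sub contDiff_id),
      ρc.comp_homeomorph (Homeomorph.subLeft x), ?_⟩
    have : Function.support (fun t => ρ (x - t)) ⊆ Metric.closedBall x (bumpSeq d k).rOut := by
      intro t ht
      have : x - t ∈ Function.support ρ := ht
      rw [hρ, ContDiffBump.support_normed_eq] at this
      simpa [dist_eq_norm, norm_sub_rev] using le_of_lt (mem_ball_zero_iff.1 this)
    exact (closure_minimal this Metric.isClosed_closedBall).trans hx
  have hg : ∀ t w, inner ℝ w (gradient (fun t => ρ (x - t)) t) = - fderiv ℝ ρ (x - t) w := by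
    intro t w
    rw [real_inner_comm, inner_gradient_left]
    have h1 : HasFDerivAt (fun t => ρ (x - t)) ((fderiv ℝ ρ (x - t)).comp
        (-ContinuousLinearMap.id ℝ (E d))) t :=
      ((ρs.differentiable (by simp)) (x - t)).hasFDerivAt.comp t
        ((hasFDerivAt_id t).const_sub x)
    rw [h1.fderiv]; simp
  have hρ1 : ContDiff ℝ 1 ρ := ρs.of_le (by exact_mod_cast le_top)
  have hfd := ρc.hasFDerivAt_convolution_left (lsmul ℝ ℝ) hρ1 hu x
  have key : ∀ w, fderiv ℝ (mollify k (Ω.indicator u)) x w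
      = ∫ t, fderiv ℝ ρ (x - t) w * Ω.indicator u t := by
    intro w
    rw [mollify, hfd.fderiv, convolution_eq_swap, ContinuousLinearMap.integral_apply]
    · simp
    · have := (ρc.fderiv ℝ).convolutionExists_left ((lsmul ℝ ℝ).precompL (E d))
        (hρ1.continuous_fderiv one_ne_zero) hu x
      exact this.integrable_swap
  refine ext_inner_left ℝ fun w => ?_
  have hw := congrArg (inner ℝ w) (h.weak _ ht)
  have hi : Integrable (fun t => u t • gradient (fun t => ρ (x - t)) t) (volume.restrict Ω) := by
    have hc : Continuous (gradient (fun t => ρ (x - t))) :=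
      (InnerProductSpace.toDual ℝ (E d)).symm.continuous.comp (ht.1.continuous_fderiv (by simp))
    have hs : HasCompactSupport (gradient (fun t => ρ (x - t))) :=
      (ht.2.1.fderiv ℝ).comp_left (g := (InnerProductSpace.toDual ℝ (E d)).symm) (map_zero _)
    refine (hu.integrable_smul_right_of_hasCompactSupport hc hs).restrict.congr ?_
    filter_upwards [ae_restrict_mem hΩ.measurableSet] with t ht
    simp [Set.indicator_of_mem ht]
  rw [← integral_inner hi, inner_neg_right] at hw
  have e1 : inner ℝ w (gradient (mollify k (Ω.indicator u)) x)
      = ∫ t in Ω, fderiv ℝ ρ (x - t) w * u t := by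
    rw [real_inner_comm, inner_gradient_left, key, ← integral_indicator hΩ.measurableSet]
    simp_rw [Set.indicator_mul_right]
  have e2 : mollify k (Ω.indicator G) x = ∫ t in Ω, ρ (x - t) • G t := by
    rw [mollify, convolution_eq_swap, ← integral_indicator hΩ.measurableSet]
    refine integral_congr_ae (.of_forall fun t => ?_)
    by_cases h : t ∈ Ω <;> simp [h, hρ]
  rw [e1, e2, ← neg_inj, ← hw, ← integral_neg]
  simp_rw [inner_smul_right, hg, mul_neg, mul_comm]

end

/-! ### The chain rule in `H¹` for smooth bounded functions -/

section

variable {d : ℕ}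

/-- Bounded smooth functions with bounded derivative. -/
structure IsCutoff (η : ℝ → ℝ) (C : ℝ) : Prop where
  contDiff : ContDiff ℝ (⊤ : ℕ∞) η
  bound : ∀ s, |η s| ≤ C
  bound_deriv : ∀ s, |deriv η s| ≤ C

theorem IsCutoff.continuous_deriv {η : ℝ → ℝ} {C : ℝ} (hη : IsCutoff η C) :
    Continuous (deriv η) :=
  hη.contDiff.continuous_deriv (by simp)

theorem IsCutoff.abs_sub_le {η : ℝ → ℝ} {C : ℝ} (hη : IsCutoff η C) (s t : ℝ) :
    |η s - η t| ≤ C * |s - t| :=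
  Convex.norm_image_sub_le_of_norm_deriv_le (fun x _ => hη.contDiff.differentiable (by simp) x)
    (fun x _ => hη.bound_deriv x) convex_univ (Set.mem_univ t) (Set.mem_univ s)

theorem IsCutoff.gradient_comp {η : ℝ → ℝ} {C : ℝ} (hη : IsCutoff η C) {v : E d → ℝ}
    (hv : ContDiff ℝ (⊤ : ℕ∞) v) (x : E d) :
    gradient (fun y => η (v y)) x = deriv η (v x) • gradient v x := by
  have h := ((hη.contDiff.differentiable (by simp) (v x)).hasDerivAt).comp_hasFDerivAt x
    (hv.differentiable (by simp) x).hasFDerivAt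
  have h' : fderiv ℝ (fun y => η (v y)) x = deriv η (v x) • fderiv ℝ v x := h.fderiv
  simp [gradient, h']

theorem continuous_gradient {v : E d → ℝ} (hv : ContDiff ℝ (⊤ : ℕ∞) v) :
    Continuous (gradient v) :=
  (InnerProductSpace.toDual ℝ (E d)).symm.continuous.comp (hv.continuous_fderiv (by simp))

theorem hasCompactSupport_gradient {v : E d → ℝ} (hv : HasCompactSupport v) :
    HasCompactSupport (gradient v) :=
  (hv.fderiv ℝ).comp_left (g := (InnerProductSpace.toDual ℝ (E d)).symm) (map_zero _)

theorem gradient_eq_zero_of_notMem_tsupport {v : E d → ℝ} {x : E d} (hx : x ∉ tsupport v) :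
    gradient v x = 0 := by
  have : fderiv ℝ v x = 0 :=
    image_eq_zero_of_notMem_tsupport fun h => hx (tsupport_fderiv_subset ℝ h)
  simp [gradient, this]

theorem memLp_comp {Ω : Set (E d)} [IsFiniteMeasure (volume.restrict Ω)] {u : E d → ℝ}
    (hu : AEStronglyMeasurable u (volume.restrict Ω)) {η : ℝ → ℝ} {C : ℝ} (hη : IsCutoff η C) :
    MemLp (fun x => η (u x)) 2 (volume.restrict Ω) :=
  MemLp.of_bound (hη.contDiff.continuous.comp_aestronglyMeasurable hu) C
    (.of_forall fun _ => hη.bound _)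

theorem memLp_comp_grad {Ω : Set (E d)} {u : E d → ℝ} {G : E d → E d}
    (hu : AEStronglyMeasurable u (volume.restrict Ω)) (hG : MemLp G 2 (volume.restrict Ω))
    {η : ℝ → ℝ} {C : ℝ} (hη : IsCutoff η C) :
    MemLp (fun x => deriv η (u x) • G x) 2 (volume.restrict Ω) := by
  refine hG.of_le_mul (c := C)
    ((hη.continuous_deriv.comp_aestronglyMeasurable hu).smul hG.1) (.of_forall fun x => ?_)
  rw [norm_smul]
  exact mul_le_mul_of_nonneg_right (hη.bound_deriv _) (norm_nonneg _)

/-- The chain rule in `H¹(Ω)`. -/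
theorem IsH1.comp {Ω : Set (E d)} (hΩ : IsOpen Ω) [IsFiniteMeasure (volume.restrict Ω)]
    {u : E d → ℝ} {G : E d → E d} (h : IsH1 Ω u G) {η : ℝ → ℝ} {C : ℝ} (hη : IsCutoff η C) :
    IsH1 Ω (fun x => η (u x)) (fun x => deriv η (u x) • G x) := by
  refine ⟨memLp_comp h.memLp.1 hη, memLp_comp_grad h.memLp.1 h.memLp_grad hη, fun φ hφ => ?_⟩
  have iu : Integrable (Ω.indicator u) :=
    (integrable_indicator_iff hΩ.measurableSet).2 (h.memLp.integrable one_le_two)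
  have iG : Integrable (Ω.indicator G) :=
    (integrable_indicator_iff hΩ.measurableSet).2 (h.memLp_grad.integrable one_le_two)
  set U := Ω.indicator u with hU
  set H := Ω.indicator G with hH
  have hv := fun k => contDiff_mollify iu.locallyIntegrable k
  have cφ : Continuous φ := hφ.1.continuous
  obtain ⟨B, hB⟩ : ∃ B, ∀ x, ‖φ x‖ ≤ B := hφ.2.1.exists_bound_of_continuous cφ
  have hB0 : 0 ≤ B := (norm_nonneg _).trans (hB 0)
  have igφ : Integrable (gradient φ) :=
    (continuous_gradient hφ.1).integrable_of_hasCompactSupport (hasCompactSupport_gradient hφ.2.1)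
  have hae := ae_tendsto_mollify iu.locallyIntegrable
  have cη := hη.contDiff.continuous
  have cη' := hη.continuous_deriv
  -- the identity for the mollified functions
  have hk : ∀ᶠ k in atTop, ∫ x, η (mollify k U x) • gradient φ x
      = -∫ x, (φ x * deriv η (mollify k U x)) • mollify k H x := by
    -- Once the mollification radius is below the distance `δ` kept from the boundary, the gradient
    -- of the mollification is the mollified gradient on the support of `φ`.
    obtain ⟨δ, hδ, hsub⟩ := hφ.2.1.isCompact.exists_cthickening_subset_open hΩ hφ.2.2
    filter_upwards [tendsto_bumpSeq_rOut.eventually_lt_const hδ] with k hkδ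
    rw [integral_smul_gradient_eq_neg (v := fun x => η (mollify k U x))
      ((hη.contDiff.comp (hv k)).of_le (by exact_mod_cast le_top))
      (hφ.1.of_le (by exact_mod_cast le_top)) hφ.2.1]
    congr 1
    refine integral_congr_ae (.of_forall fun x => ?_)
    by_cases hx : x ∈ tsupport φ
    · have : Metric.closedBall x (bumpSeq d k).rOut ⊆ Ω :=
        ((Metric.closedBall_subset_closedBall hkδ.le).trans
          (Metric.closedBall_subset_cthickening hx δ)).trans hsub
      have e := hη.gradient_comp (hv k) x
      rw [hU, gradient_mollify hΩ h iu.locallyIntegrable this] at e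
      simp only [hU, hH, mul_smul]
      rw [← e]
    · simp [image_eq_zero_of_notMem_tsupport hx]
  have lim1 : Tendsto (fun k => ∫ x, η (mollify k U x) • gradient φ x) atTop
      (𝓝 (∫ x, η (U x) • gradient φ x)) := by
    refine tendsto_integral_of_dominated_convergence (fun x => C * ‖gradient φ x‖)
      (fun k => ((cη.comp (hv k).continuous).aestronglyMeasurable.smul igφ.1))
      (igφ.norm.const_mul C) (fun k => .of_forall fun x => ?_) ?_
    · rw [norm_smul]
      exact mul_le_mul_of_nonneg_right (hη.bound _) (norm_nonneg _)
    · filter_upwards [hae] with x hx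
      exact ((cη.tendsto _).comp hx).smul_const _
  have m1 : ∀ k, AEStronglyMeasurable (fun x => φ x * deriv η (mollify k U x)) volume := fun k =>
    (cφ.mul (cη'.comp (hv k).continuous)).aestronglyMeasurable
  have b1 : ∀ x s, ‖φ x * deriv η s‖ ≤ B * C := fun x s => by
    rw [norm_mul]
    exact mul_le_mul (hB x) (hη.bound_deriv s) (norm_nonneg _) hB0
  have i1 : ∀ k, Integrable fun x =>
      (φ x * deriv η (mollify k U x)) • (mollify k H x - H x) := fun k =>
    ((integrable_mollify iG k).sub iG).bdd_smul (B * C) (m1 k) (.of_forall fun x => b1 _ _)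
  have i2 : ∀ k, Integrable fun x => (φ x * deriv η (mollify k U x)) • H x := fun k =>
    iG.bdd_smul (B * C) (m1 k) (.of_forall fun x => b1 _ _)
  -- The gradients converge only in `L¹` and the factors `η'` only boundedly a.e.; the product is
  -- split so that each term uses one of the two.
  have lim2 : Tendsto (fun k => ∫ x, (φ x * deriv η (mollify k U x)) • (mollify k H x - H x))
      atTop (𝓝 0) := by
    have := (tendsto_integral_norm_mollify_sub iG).const_mul (B * C)
    rw [mul_zero] at this
    refine squeeze_zero_norm (fun k => ?_) this
    rw [← integral_const_mul]
    refine (norm_integral_le_integral_norm _).trans (integral_mono (i1 k).norm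
      (((integrable_mollify iG k).sub iG).norm.const_mul _) fun x => ?_)
    rw [norm_smul]
    exact mul_le_mul_of_nonneg_right (b1 _ _) (norm_nonneg _)
  have lim3 : Tendsto (fun k => ∫ x, (φ x * deriv η (mollify k U x)) • H x)
      atTop (𝓝 (∫ x, (φ x * deriv η (U x)) • H x)) := by
    refine tendsto_integral_of_dominated_convergence (fun x => B * C * ‖H x‖)
      (fun k => (i2 k).1) (iG.norm.const_mul _) (fun k => .of_forall fun x => ?_) ?_
    · rw [norm_smul]
      exact mul_le_mul_of_nonneg_right (b1 _ _) (norm_nonneg _)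
    · filter_upwards [hae] with x hx
      exact (((cη'.tendsto _).comp hx).const_mul _).smul_const _
  have lim4 : Tendsto (fun k => ∫ x, η (mollify k U x) • gradient φ x) atTop
      (𝓝 (-∫ x, (φ x * deriv η (U x)) • H x)) := by
    have := (lim2.add lim3).neg
    rw [zero_add] at this
    refine this.congr' ?_
    filter_upwards [hk] with k hk
    rw [hk, ← integral_add (i1 k) (i2 k)]
    congr 2 with x : 1
    rw [← smul_add, sub_add_cancel]
  have e := tendsto_nhds_unique lim1 lim4
  have z : ∀ x, x ∉ Ω → φ x = 0 := fun x hx =>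
    image_eq_zero_of_notMem_tsupport fun h => hx (hφ.2.2 h)
  have z' : ∀ x, x ∉ Ω → gradient φ x = 0 := fun x hx =>
    gradient_eq_zero_of_notMem_tsupport fun h => hx (hφ.2.2 h)
  rw [← setIntegral_eq_integral_of_forall_compl_eq_zero (s := Ω) (f := fun x => η (U x) • _)
      (fun x hx => by rw [z' x hx, smul_zero]),
    ← setIntegral_eq_integral_of_forall_compl_eq_zero (s := Ω) (f := fun x => (φ x * _) • H x)
      (fun x hx => by rw [z x hx, zero_mul, zero_smul])] at e
  rw [setIntegral_congr_fun (g := fun x => η (U x) • gradient φ x) hΩ.measurableSet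
    (fun x hx => by simp [hU, hx]), e]
  congr 1
  refine setIntegral_congr_fun hΩ.measurableSet fun x hx => ?_
  simp [hU, hH, hx, mul_smul]

end

/-! ### Closure of the boundary-condition spaces under composition and subtraction -/

section

variable {d : ℕ}

theorem tendsto_eLpNorm_two_of_dominated {X V : Type*} [MeasurableSpace X] {μ : Measure X}
    [NormedAddCommGroup V] {h : ℕ → X → V} {g : X → ℝ} (hm : ∀ k, AEStronglyMeasurable (h k) μ)
    (hg : MemLp g 2 μ) (hb : ∀ k x, ‖h k x‖ ≤ g x)
    (hl : ∀ᵐ x ∂μ, Tendsto (fun k => h k x) atTop (𝓝 0)) :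
    Tendsto (fun k => eLpNorm (h k) 2 μ) atTop (𝓝 0) := by
  have e : ∀ k, eLpNorm (h k) 2 μ = (∫⁻ x, ‖h k x‖ₑ ^ (2 : ℝ) ∂μ) ^ (1 / 2 : ℝ) := fun k => by
    rw [eLpNorm_eq_lintegral_rpow_enorm_toReal two_ne_zero ENNReal.ofNat_ne_top]; simp
  have hfin : ∫⁻ x, ‖g x‖ₑ ^ (2 : ℝ) ∂μ ≠ ⊤ := by
    have := lintegral_rpow_enorm_lt_top_of_eLpNorm_lt_top two_ne_zero ENNReal.ofNat_ne_top hg.2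
    simpa using this.ne
  have lim : Tendsto (fun k => ∫⁻ x, ‖h k x‖ₑ ^ (2 : ℝ) ∂μ) atTop (𝓝 0) := by
    have := tendsto_lintegral_of_dominated_convergence' (μ := μ)
      (F := fun k x => ‖h k x‖ₑ ^ (2 : ℝ)) (f := fun _ => 0) (fun x => ‖g x‖ₑ ^ (2 : ℝ))
      (fun k => (hm k).enorm.pow_const _) (fun k => .of_forall fun x => ?_) hfin ?_
    · simpa using this
    · refine ENNReal.rpow_le_rpow ?_ zero_le_two
      rw [enorm_le_iff_norm_le]
      exact (hb k x).trans (le_abs_self _)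
    · filter_upwards [hl] with x hx
      have := ((continuous_enorm.tendsto _).comp hx)
      have := (ENNReal.continuous_rpow_const (y := 2)).tendsto _ |>.comp this
      simpa [Function.comp_def] using this
  simp_rw [e]
  have := (ENNReal.continuous_rpow_const (y := 1 / 2)).tendsto _ |>.comp lim
  simpa [Function.comp_def] using this

/-- The gradient error splits as `η'(ψ) (∇ψ - G) + (η'(ψ) - η'(u)) G`. The first term is small in
`L²` because `η'` is bounded; the second needs dominated convergence, hence the passage to a
subsequence converging a.e. -/
theorem IsH1LimitOf.comp {Ω : Set (E d)} {C : (E d → ℝ) → Prop} {u : E d → ℝ} {G : E d → E d}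
    (h : IsH1LimitOf Ω C u G) (hu : AEStronglyMeasurable u (volume.restrict Ω))
    (hG : MemLp G 2 (volume.restrict Ω)) {η : ℝ → ℝ} {B : ℝ} (hη : IsCutoff η B)
    (hC : ∀ φ, C φ → ContDiff ℝ (⊤ : ℕ∞) φ) (hCη : ∀ φ, C φ → C fun x => η (φ x)) :
    IsH1LimitOf Ω C (fun x => η (u x)) (fun x => deriv η (u x) • G x) := by
  obtain ⟨ψ, hψ, hψu, hψG⟩ := h
  set μ := volume.restrict Ω
  have mψ : ∀ k, AEStronglyMeasurable (ψ k) μ := fun k =>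
    (hC _ (hψ k)).continuous.aestronglyMeasurable
  obtain ⟨ns, hns, hae⟩ :=
    (tendstoInMeasure_of_tendsto_eLpNorm two_ne_zero mψ hu hψu).exists_seq_tendsto_ae
  have cη' := hη.continuous_deriv
  refine ⟨fun k x => η (ψ (ns k) x), fun k => hCη _ (hψ _), ?_, ?_⟩
  · have := (ENNReal.Tendsto.const_mul (a := ENNReal.ofReal B) (hψu.comp hns.tendsto_atTop)
      (.inr ENNReal.ofReal_ne_top))
    rw [mul_zero] at this
    refine tendsto_of_tendsto_of_tendsto_of_le_of_le tendsto_const_nhds this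
      (fun _ => zero_le) fun k => ?_
    exact eLpNorm_le_mul_eLpNorm_of_ae_le_mul (.of_forall fun x => hη.abs_sub_le _ _) 2
  · have l1 : Tendsto (fun k => eLpNorm (fun x => deriv η (ψ (ns k) x) •
        (gradient (ψ (ns k)) x - G x)) 2 μ) atTop (𝓝 0) := by
      have := (ENNReal.Tendsto.const_mul (a := ENNReal.ofReal B) (hψG.comp hns.tendsto_atTop)
        (.inr ENNReal.ofReal_ne_top))
      rw [mul_zero] at this
      refine tendsto_of_tendsto_of_tendsto_of_le_of_le tendsto_const_nhds this
        (fun _ => zero_le) fun k => ?_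
      refine eLpNorm_le_mul_eLpNorm_of_ae_le_mul (.of_forall fun x => ?_) 2
      rw [norm_smul]
      exact mul_le_mul_of_nonneg_right (hη.bound_deriv _) (norm_nonneg _)
    have m2 : ∀ k, AEStronglyMeasurable (fun x => (deriv η (ψ (ns k) x) - deriv η (u x)) • G x) μ :=
      fun k => ((cη'.comp_aestronglyMeasurable (mψ _)).sub
        (cη'.comp_aestronglyMeasurable hu)).smul hG.1
    have l2 : Tendsto (fun k => eLpNorm (fun x => (deriv η (ψ (ns k) x) - deriv η (u x)) • G x) 2 μ)
        atTop (𝓝 0) := by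
      refine tendsto_eLpNorm_two_of_dominated m2 (hG.norm.const_mul (B + B)) (fun k x => ?_) ?_
      · rw [norm_smul]
        exact mul_le_mul_of_nonneg_right ((norm_sub_le _ _).trans
          (add_le_add (hη.bound_deriv _) (hη.bound_deriv _))) (norm_nonneg _)
      · filter_upwards [hae] with x hx
        have := (((cη'.tendsto _).comp hx).sub_const (deriv η (u x))).smul_const (G x)
        simpa using this
    have m1 : ∀ k, AEStronglyMeasurable (fun x => deriv η (ψ (ns k) x) •
        (gradient (ψ (ns k)) x - G x)) μ := fun k =>
      (cη'.comp_aestronglyMeasurable (mψ _)).smul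
        ((continuous_gradient (hC _ (hψ _))).aestronglyMeasurable.sub hG.1)
    refine tendsto_of_tendsto_of_tendsto_of_le_of_le tendsto_const_nhds
      (by simpa using l1.add l2) (fun _ => zero_le) fun k => ?_
    refine le_trans (le_of_eq ?_) (eLpNorm_add_le (m1 k) (m2 k) one_le_two)
    congr 1
    funext x
    rw [hη.gradient_comp (hC _ (hψ _))]
    simp only [Pi.add_apply, smul_sub, sub_smul]
    abel

theorem gradient_sub {v w : E d → ℝ} (hv : ContDiff ℝ (⊤ : ℕ∞) v) (hw : ContDiff ℝ (⊤ : ℕ∞) w)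
    (x : E d) : gradient (fun y => v y - w y) x = gradient v x - gradient w x := by
  have : fderiv ℝ (fun y => v y - w y) x = fderiv ℝ v x - fderiv ℝ w x :=
    fderiv_fun_sub (hv.differentiable (by simp) x) (hw.differentiable (by simp) x)
  simp [gradient, this]

theorem IsH1LimitOf.sub {Ω : Set (E d)} {C : (E d → ℝ) → Prop} {u v : E d → ℝ} {G H : E d → E d}
    (hu : IsH1LimitOf Ω C u G) (hv : IsH1LimitOf Ω C v H) (h1 : IsH1 Ω u G) (h2 : IsH1 Ω v H)
    (hC : ∀ φ, C φ → ContDiff ℝ (⊤ : ℕ∞) φ) (hsub : ∀ φ ψ, C φ → C ψ → C fun x => φ x - ψ x) :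
    IsH1LimitOf Ω C (fun x => u x - v x) (fun x => G x - H x) := by
  obtain ⟨φ, hφ, hφu, hφG⟩ := hu
  obtain ⟨ψ, hψ, hψv, hψH⟩ := hv
  refine ⟨fun k x => φ k x - ψ k x, fun k => hsub _ _ (hφ k) (hψ k), ?_, ?_⟩
  · refine tendsto_of_tendsto_of_tendsto_of_le_of_le tendsto_const_nhds
      (by simpa using hφu.add hψv) (fun _ => zero_le) fun k => ?_
    refine le_trans (le_of_eq ?_) (eLpNorm_sub_le
      ((hC _ (hφ k)).continuous.aestronglyMeasurable.sub h1.memLp.1)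
      ((hC _ (hψ k)).continuous.aestronglyMeasurable.sub h2.memLp.1) one_le_two)
    congr 1
    funext x
    simp only [Pi.sub_apply]
    ring
  · refine tendsto_of_tendsto_of_tendsto_of_le_of_le tendsto_const_nhds
      (by simpa using hφG.add hψH) (fun _ => zero_le) fun k => ?_
    refine le_trans (le_of_eq ?_) (eLpNorm_sub_le
      ((continuous_gradient (hC _ (hφ k))).aestronglyMeasurable.sub h1.memLp_grad.1)
      ((continuous_gradient (hC _ (hψ k))).aestronglyMeasurable.sub h2.memLp_grad.1) one_le_two)
    congr 1
    funext x
    rw [gradient_sub (hC _ (hφ k)) (hC _ (hψ k))]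
    simp only [Pi.sub_apply]
    abel

theorem IsH1.sub {Ω : Set (E d)} [IsFiniteMeasure (volume.restrict Ω)] {u v : E d → ℝ}
    {G H : E d → E d} (hu : IsH1 Ω u G) (hv : IsH1 Ω v H) :
    IsH1 Ω (fun x => u x - v x) (fun x => G x - H x) := by
  refine ⟨hu.memLp.sub hv.memLp, hu.memLp_grad.sub hv.memLp_grad, fun φ hφ => ?_⟩
  obtain ⟨B, hB⟩ := hφ.2.1.exists_bound_of_continuous hφ.1.continuous
  obtain ⟨B', hB'⟩ := (hasCompactSupport_gradient hφ.2.1).exists_bound_of_continuous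
    (continuous_gradient hφ.1)
  have i1 : ∀ {w : E d → ℝ} {K : E d → E d}, IsH1 Ω w K →
      Integrable (fun x => w x • gradient φ x) (volume.restrict Ω) := fun h =>
    (h.memLp.integrable one_le_two).smul_bdd B'
      (continuous_gradient hφ.1).aestronglyMeasurable (.of_forall hB')
  have i2 : ∀ {w : E d → ℝ} {K : E d → E d}, IsH1 Ω w K →
      Integrable (fun x => φ x • K x) (volume.restrict Ω) := fun h =>
    (h.memLp_grad.integrable one_le_two).bdd_smul B
      hφ.1.continuous.aestronglyMeasurable (.of_forall hB)
  simp_rw [sub_smul, smul_sub]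
  rw [integral_sub (i1 hu) (i1 hv), integral_sub (i2 hu) (i2 hv), hu.weak φ hφ, hv.weak φ hφ]
  abel

theorem IsTestFunction.sub {Ω : Set (E d)} {φ ψ : E d → ℝ} (hφ : IsTestFunction Ω φ)
    (hψ : IsTestFunction Ω ψ) : IsTestFunction Ω fun x => φ x - ψ x :=
  ⟨hφ.1.sub hψ.1, hφ.2.1.sub hψ.2.1,
    (tsupport_sub φ ψ).trans (Set.union_subset hφ.2.2 hψ.2.2)⟩

theorem IsTestFunction.comp {Ω : Set (E d)} {φ : E d → ℝ} (hφ : IsTestFunction Ω φ)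
    {η : ℝ → ℝ} (hη : ContDiff ℝ (⊤ : ℕ∞) η) (h0 : η 0 = 0) :
    IsTestFunction Ω fun x => η (φ x) :=
  ⟨hη.comp hφ.1, hφ.2.1.comp_left h0,
    (closure_mono (Function.support_comp_subset h0 φ)).trans hφ.2.2⟩

theorem BoundaryCondition.Space.isH1 {Ω : Set (E d)} {bc : BoundaryCondition d} {u : E d → ℝ}
    {G : E d → E d} (h : bc.Space Ω u G) : IsH1 Ω u G := by
  cases bc with
  | dirichlet => exact h.1
  | neumann => exact h
  | periodic a b => exact h.1

theorem BoundaryCondition.Space.sub {Ω : Set (E d)} [IsFiniteMeasure (volume.restrict Ω)]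
    {bc : BoundaryCondition d} {u v : E d → ℝ} {G H : E d → E d}
    (hu : bc.Space Ω u G) (hv : bc.Space Ω v H) :
    bc.Space Ω (fun x => u x - v x) (fun x => G x - H x) := by
  cases bc with
  | dirichlet =>
    exact ⟨hu.1.sub hv.1, hu.2.sub hv.2 hu.1 hv.1 (fun _ h => h.1) fun _ _ h h' => h.sub h'⟩
  | neumann => exact IsH1.sub hu hv
  | periodic a b =>
    exact ⟨hu.1.sub hv.1, hu.2.sub hv.2 hu.1 hv.1 (fun _ h => h.1) fun _ _ h h' =>
      ⟨h.1.sub h'.1, fun x i => by simp only [h.2, h'.2]⟩⟩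

/-- The chain rule in the space that belongs to a boundary condition. -/
theorem BoundaryCondition.Space.comp {Ω : Set (E d)} (hΩ : IsOpen Ω)
    [IsFiniteMeasure (volume.restrict Ω)] {bc : BoundaryCondition d} {u : E d → ℝ}
    {G : E d → E d} (hu : bc.Space Ω u G) {η : ℝ → ℝ} {C : ℝ} (hη : IsCutoff η C)
    (h0 : η 0 = 0) : bc.Space Ω (fun x => η (u x)) (fun x => deriv η (u x) • G x) := by
  cases bc with
  | dirichlet =>
    exact ⟨hu.1.comp hΩ hη, hu.2.comp hu.1.memLp.1 hu.1.memLp_grad hη (fun _ h => h.1)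
      fun _ h => h.comp hη.contDiff h0⟩
  | neumann => exact IsH1.comp hΩ hu hη
  | periodic a b =>
    exact ⟨hu.1.comp hΩ hη, hu.2.comp hu.1.memLp.1 hu.1.memLp_grad hη (fun _ h => h.1)
      fun _ h => ⟨hη.contDiff.comp h.1, fun x i => by simp only [h.2]⟩⟩

/-! ### The maximum principle -/

/-- A smooth nondecreasing function that vanishes exactly on the half-line up to `1`. -/
noncomputable def upperCutoff (s : ℝ) : ℝ := expNegInvGlue (s - 1)

theorem isCutoff_upperCutoff : IsCutoff upperCutoff 2 where
  contDiff := expNegInvGlue.contDiff.comp (contDiff_id.sub contDiff_const)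
  bound s := by
    rw [upperCutoff, abs_of_nonneg (expNegInvGlue.nonneg _), expNegInvGlue]
    split_ifs with h
    · norm_num
    · have : Real.exp (-(s - 1)⁻¹) ≤ 1 :=
        Real.exp_le_one_iff.2 (neg_nonpos.2 (inv_nonneg.2 (not_le.1 h).le))
      linarith
  bound_deriv s := by
    have h := (expNegInvGlue.hasDerivAt_polynomial_eval_inv_mul 1 (s - 1)).comp_sub_const s 1
    simp only [Polynomial.eval_one, one_mul, Polynomial.derivative_one, sub_zero, mul_one,
      Polynomial.eval_pow, Polynomial.eval_X] at h
    have : deriv upperCutoff s = (s - 1)⁻¹ ^ 2 * expNegInvGlue (s - 1) := h.deriv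
    rw [this, abs_of_nonneg (mul_nonneg (sq_nonneg _) (expNegInvGlue.nonneg _)), expNegInvGlue]
    split_ifs with h
    · norm_num
    -- With `y = (s - 1)⁻¹` the derivative is `y² exp (-y)`, and `exp y ≥ 1 + y + y²/2` bounds it by
    -- `2`.
    · have h1 := Real.quadratic_le_exp_of_nonneg (inv_nonneg.2 (not_le.1 h).le)
      have h2 : 0 < (s - 1)⁻¹ := inv_pos.2 (not_le.1 h)
      rw [Real.exp_neg, ← div_eq_mul_inv, div_le_iff₀ (Real.exp_pos _)]
      linarith

theorem monotone_upperCutoff : Monotone upperCutoff := fun _ _ h =>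
  expNegInvGlue.monotone (by linarith)

/-- A smooth nondecreasing function that vanishes exactly on the half-line from `-1`. -/
noncomputable def lowerCutoff (s : ℝ) : ℝ := -upperCutoff (-s)

theorem isCutoff_lowerCutoff : IsCutoff lowerCutoff 2 where
  contDiff := (isCutoff_upperCutoff.contDiff.comp contDiff_neg).neg
  bound s := by rw [lowerCutoff, abs_neg]; exact isCutoff_upperCutoff.bound _
  bound_deriv s := by
    have : deriv lowerCutoff s = deriv upperCutoff (-s) := by
      change deriv (fun s => -upperCutoff (-s)) s = _
      rw [deriv.fun_neg, deriv_comp_neg, neg_neg]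
    rw [this]
    exact isCutoff_upperCutoff.bound_deriv _

theorem monotone_lowerCutoff : Monotone lowerCutoff := fun _ _ h =>
  neg_le_neg (monotone_upperCutoff (neg_le_neg h))

/-- Green's formula tested with `η (u)` turns the integral into `-∫ η'(u) ‖G‖²`. The condition `η 0
= 0` keeps compact supports in the Dirichlet case. -/
theorem IsLaplacian.integral_mul_comp_nonpos {Ω : Set (E d)} (hΩ : IsOpen Ω)
    [IsFiniteMeasure (volume.restrict Ω)] {bc : BoundaryCondition d} {u w : E d → ℝ}
    {G : E d → E d} (hL : IsLaplacian Ω bc G w) (hu : bc.Space Ω u G) {η : ℝ → ℝ} {C : ℝ}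
    (hη : IsCutoff η C) (h0 : η 0 = 0) (hmono : Monotone η) : ∫ x in Ω, w x * η (u x) ≤ 0 := by
  have h := hL.green _ _ (hu.comp hΩ hη h0)
  have : 0 ≤ ∫ x in Ω, inner ℝ (G x) (deriv η (u x) • G x) := integral_nonneg fun x => by
    rw [inner_smul_right]
    exact mul_nonneg hmono.deriv_nonneg real_inner_self_nonneg
  linarith

theorem IsLaplacian.ae_comp_eq_zero {Ω : Set (E d)} (hΩ : IsOpen Ω)
    [IsFiniteMeasure (volume.restrict Ω)] {bc : BoundaryCondition d} {u w : E d → ℝ}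
    {G : E d → E d} (hL : IsLaplacian Ω bc G w) (hu : bc.Space Ω u G) {η : ℝ → ℝ} {C : ℝ}
    (hη : IsCutoff η C) (h0 : η 0 = 0) (hmono : Monotone η)
    (hw : ∀ᵐ x ∂(volume.restrict Ω), η (u x) ≠ 0 → 0 < w x * η (u x)) :
    ∀ᵐ x ∂(volume.restrict Ω), η (u x) = 0 := by
  have hn : 0 ≤ᵐ[volume.restrict Ω] fun x => w x * η (u x) := by
    filter_upwards [hw] with x hx
    by_cases h : η (u x) = 0
    · simp [h]
    · exact (hx h).le
  have hi : Integrable (fun x => w x * η (u x)) (volume.restrict Ω) :=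
    hL.memLp.integrable_mul (memLp_comp hu.isH1.memLp.1 hη)
  have hz := (integral_eq_zero_iff_of_nonneg_ae hn hi).1
    (le_antisymm (hL.integral_mul_comp_nonpos hΩ hu hη h0 hmono) (integral_nonneg_of_ae hn))
  filter_upwards [hw, hz] with x hx hx0
  by_contra h
  exact (hx h).ne' hx0

/-- The maximum principle. -/
theorem IsLaplacian.ae_abs_le_one {Ω : Set (E d)} (hΩ : IsOpen Ω)
    [IsFiniteMeasure (volume.restrict Ω)] {bc : BoundaryCondition d} {u w : E d → ℝ}
    {G : E d → E d} (hL : IsLaplacian Ω bc G w) (hu : bc.Space Ω u G)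
    (hpos : ∀ᵐ x ∂(volume.restrict Ω), 1 < u x → 0 < w x)
    (hneg : ∀ᵐ x ∂(volume.restrict Ω), u x < -1 → w x < 0) :
    ∀ᵐ x ∂(volume.restrict Ω), |u x| ≤ 1 := by
  have e1 : ∀ s, upperCutoff s = 0 ↔ s ≤ 1 := fun s => by
    rw [upperCutoff, expNegInvGlue.zero_iff_nonpos, sub_nonpos]
  have e2 : ∀ s, lowerCutoff s = 0 ↔ -1 ≤ s := fun s => by
    rw [lowerCutoff, neg_eq_zero, e1, neg_le]
  have h1 := hL.ae_comp_eq_zero hΩ hu isCutoff_upperCutoff ((e1 0).2 (by norm_num))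
    monotone_upperCutoff (by
      filter_upwards [hpos] with x hx h
      exact mul_pos (hx (not_le.1 ((e1 _).not.1 h)))
        ((expNegInvGlue.nonneg _).lt_of_ne' h))
  have h2 := hL.ae_comp_eq_zero hΩ hu isCutoff_lowerCutoff ((e2 0).2 (by norm_num))
    monotone_lowerCutoff (by
      filter_upwards [hneg] with x hx h
      exact mul_pos_of_neg_of_neg (hx (not_le.1 ((e2 _).not.1 h)))
        ((neg_nonpos.2 (expNegInvGlue.nonneg _)).lt_of_ne h))
  filter_upwards [h1, h2] with x hx1 hx2
  exact abs_le.2 ⟨(e2 _).1 hx2, (e1 _).1 hx1⟩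

end

/-! ### The discrete Caputo derivative -/

theorem sum_Icc_one_eq_sum_range {M : Type*} [AddCommMonoid M] (g : ℕ → M) (m : ℕ) :
    ∑ k ∈ Finset.Icc 1 m, g k = ∑ k ∈ Finset.range m, g (k + 1) := by
  induction m with
  | zero => simp
  | succ m ih => rw [Finset.sum_Icc_succ_top (by lia), Finset.sum_range_succ, ih]

theorem sum_range_mul_sub (c e : ℕ → ℝ) (p : ℕ) :
    ∑ j ∈ Finset.range (p + 1), c j * (e (j + 1) - e j)
      = c p * e (p + 1) - c 0 * e 0 - ∑ k ∈ Finset.range p, (c (k + 1) - c k) * e (k + 1) := by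
  induction p with
  | zero => simp; ring
  | succ p ih => rw [Finset.sum_range_succ, ih, Finset.sum_range_succ]; ring

/-- Abel summation applied to `v j - v (m + 1)`, which kills the boundary term at the newest level.
In this form the monotonicity of the weights becomes a sign. -/
theorem discreteCaputo_succ (α τ : ℝ) (v : ℕ → ℝ) (m : ℕ) :
    discreteCaputo α τ v (m + 1)
      = ∑ k ∈ Finset.range m, (coeff α τ (m - (k + 1)) - coeff α τ (m - k)) * (v (m + 1) - v (k + 1))
        + coeff α τ m * (v (m + 1) - v 0) := by
  have h := sum_range_mul_sub (fun j => coeff α τ (m - j)) (fun j => v j - v (m + 1)) m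
  rw [discreteCaputo, sum_Icc_one_eq_sum_range]
  simp only [sub_self, mul_zero, zero_sub, Nat.sub_zero, sub_sub_sub_cancel_right] at h
  simp only [Nat.add_sub_add_right, Nat.add_sub_cancel]
  rw [h, ← sub_eq_zero]
  have : ∑ k ∈ Finset.range m, (coeff α τ (m - (k + 1)) - coeff α τ (m - k)) * (v (m + 1) - v (k + 1))
    = -∑ k ∈ Finset.range m, (coeff α τ (m - (k + 1)) - coeff α τ (m - k)) * (v (k + 1) - v (m + 1)) := by
    rw [← Finset.sum_neg_distrib]; exact Finset.sum_congr rfl fun _ _ => by ring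
  rw [this]; ring

/-- The history term of the modified energy for a scalar sequence. -/
noncomputable def history (α τ : ℝ) (v : ℕ → ℝ) (n : ℕ) : ℝ :=
  ∑ k ∈ Finset.Icc 1 (n - 1), (coeff α τ (n - k - 1) - coeff α τ (n - k)) * (v n - v k) ^ 2
    + coeff α τ (n - 1) * (v n - v 0) ^ 2

theorem history_succ (α τ : ℝ) (v : ℕ → ℝ) (m : ℕ) :
    history α τ v (m + 1)
      = ∑ k ∈ Finset.range m,
          (coeff α τ (m - (k + 1)) - coeff α τ (m - k)) * (v (m + 1) - v (k + 1)) ^ 2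
        + coeff α τ m * (v (m + 1) - v 0) ^ 2 := by
  rw [history, sum_Icc_one_eq_sum_range]
  simp only [Nat.add_sub_add_right, Nat.add_sub_cancel, Nat.sub_sub]

section

variable {α τ : ℝ}

theorem concaveOn_rpow_one_sub (hα0 : 0 < α) (hα1 : α < 1) :
    ConcaveOn ℝ (Set.Ici 0) fun x : ℝ => x ^ (1 - α) :=
  Real.concaveOn_rpow (by linarith) (by linarith)

/-- The second derivative is `α (1 - α) (x ^ (-α - 1) - (x + 1) ^ (-α - 1))`, nonnegative since a
negative power decreases. -/
theorem convexOn_rpow_increment (hα0 : 0 < α) (hα1 : α < 1) :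
    ConvexOn ℝ (Set.Ici 0) fun x : ℝ => (x + 1) ^ (1 - α) - x ^ (1 - α) := by
  refine convexOn_of_hasDerivWithinAt2_nonneg (convex_Ici 0)
    (f' := fun x => (1 - α) * (x + 1) ^ (1 - α - 1) - (1 - α) * x ^ (1 - α - 1))
    (f'' := fun x => (1 - α) * ((1 - α - 1) * (x + 1) ^ (1 - α - 1 - 1))
      - (1 - α) * ((1 - α - 1) * x ^ (1 - α - 1 - 1))) ?_ ?_ ?_ ?_
  · have : 0 ≤ 1 - α := by linarith
    exact (((continuous_id.add continuous_const).rpow_const fun _ => .inr this).sub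
      (continuous_id.rpow_const fun _ => .inr this)).continuousOn
  · intro x hx
    rw [interior_Ici] at hx
    have hx : 0 < x := hx
    have h1 := ((hasDerivAt_id x).add_const 1).rpow_const (p := 1 - α) (.inl (by simp; positivity))
    have h2 := Real.hasDerivAt_rpow_const (x := x) (p := 1 - α) (.inl hx.ne')
    simpa [Pi.sub_def] using (h1.sub h2).hasDerivWithinAt
  · intro x hx
    rw [interior_Ici] at hx
    have hx : 0 < x := hx
    have h1 := ((hasDerivAt_id x).add_const 1).rpow_const (p := 1 - α - 1)
      (.inl (by simp; positivity))
    have h2 := Real.hasDerivAt_rpow_const (x := x) (p := 1 - α - 1) (.inl hx.ne')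
    simpa [Pi.sub_def] using ((h1.const_mul (1 - α)).sub (h2.const_mul (1 - α))).hasDerivWithinAt
  · intro x hx
    rw [interior_Ici] at hx
    have hx : 0 < x := hx
    have h := Real.rpow_le_rpow_of_nonpos hx (by linarith : x ≤ x + 1)
      (by linarith : 1 - α - 1 - 1 ≤ 0)
    have : 0 ≤ (1 - α) * α * (x ^ (1 - α - 1 - 1) - (x + 1) ^ (1 - α - 1 - 1)) :=
      mul_nonneg (mul_nonneg (by linarith) hα0.le) (by linarith)
    linarith

theorem coeff_pos (hα1 : α < 1) (hτ : 0 < τ) (k : ℕ) : 0 < coeff α τ k := by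
  have h1 : 0 < Real.Gamma (2 - α) := Real.Gamma_pos_of_pos (by linarith)
  have h2 : (k : ℝ) ^ (1 - α) < ((k : ℝ) + 1) ^ (1 - α) :=
    Real.rpow_lt_rpow (by positivity) (by linarith) (by linarith)
  have h3 : 0 < τ ^ α := by positivity
  exact mul_pos (by positivity) (by linarith)

theorem midpoint_le_of_concaveOn {h : ℝ → ℝ} (hh : ConcaveOn ℝ (Set.Ici 0) h) {x : ℝ}
    (hx : 0 ≤ x) : h x + h (x + 1 + 1) ≤ 2 * h (x + 1) := by
  have := hh.2 (Set.mem_Ici.2 hx) (Set.mem_Ici.2 (by linarith : 0 ≤ x + 1 + 1))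
    (by norm_num : (0 : ℝ) ≤ 1 / 2) (by norm_num : (0 : ℝ) ≤ 1 / 2) (by norm_num)
  simp only [smul_eq_mul] at this
  rw [show 1 / 2 * x + 1 / 2 * (x + 1 + 1) = x + 1 by ring] at this
  linarith

theorem coeff_succ_le (hα0 : 0 < α) (hα1 : α < 1) (hτ : 0 < τ) (k : ℕ) :
    coeff α τ (k + 1) ≤ coeff α τ k := by
  have h1 : 0 < Real.Gamma (2 - α) := Real.Gamma_pos_of_pos (by linarith)
  have h3 : 0 < τ ^ α := by positivity
  have := midpoint_le_of_concaveOn (concaveOn_rpow_one_sub hα0 hα1) (x := k) (by positivity)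
  refine mul_le_mul_of_nonneg_left ?_ (by positivity)
  push_cast
  linarith

/-- Midpoint convexity of the increments of `x ^ (1 - α)`. It makes the history weight of a fixed
past level shrink as time advances. -/
theorem coeff_convex (hα0 : 0 < α) (hα1 : α < 1) (hτ : 0 < τ) (k : ℕ) :
    coeff α τ (k + 1) - coeff α τ (k + 2) ≤ coeff α τ k - coeff α τ (k + 1) := by
  have h1 : 0 < Real.Gamma (2 - α) := Real.Gamma_pos_of_pos (by linarith)
  have h3 : 0 < τ ^ α := by positivity
  have := midpoint_le_of_concaveOn (convexOn_rpow_increment hα0 hα1).neg (x := k) (by positivity)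
  simp only [Pi.neg_apply] at this
  unfold coeff
  rw [← mul_sub, ← mul_sub]
  refine mul_le_mul_of_nonneg_left ?_ (by positivity)
  push_cast
  rw [show (k : ℝ) + 2 = k + 1 + 1 by ring]
  linarith

theorem coeff_sub_nonneg (hα0 : 0 < α) (hα1 : α < 1) (hτ : 0 < τ) {m k : ℕ} (hk : k < m) :
    0 ≤ coeff α τ (m - (k + 1)) - coeff α τ (m - k) := by
  have := coeff_succ_le hα0 hα1 hτ (m - (k + 1))
  rw [show m - (k + 1) + 1 = m - k by lia] at this
  linarith

theorem history_nonneg (hα0 : 0 < α) (hα1 : α < 1) (hτ : 0 < τ) (v : ℕ → ℝ) (n : ℕ) :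
    0 ≤ history α τ v n := by
  cases n with
  | zero => simp [history]
  | succ m =>
    rw [history_succ]
    exact add_nonneg (Finset.sum_nonneg fun k hk =>
        mul_nonneg (coeff_sub_nonneg hα0 hα1 hτ (Finset.mem_range.1 hk)) (sq_nonneg _))
      (mul_nonneg (coeff_pos hα1 hτ m).le (sq_nonneg _))

theorem discreteCaputo_nonneg (hα0 : 0 < α) (hα1 : α < 1) (hτ : 0 < τ) {v : ℕ → ℝ} {m : ℕ}
    (h : ∀ k ≤ m, v k ≤ v (m + 1)) : 0 ≤ discreteCaputo α τ v (m + 1) := by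
  rw [discreteCaputo_succ]
  refine add_nonneg (Finset.sum_nonneg fun k hk =>
      mul_nonneg (coeff_sub_nonneg hα0 hα1 hτ (Finset.mem_range.1 hk)) ?_)
    (mul_nonneg (coeff_pos hα1 hτ m).le (sub_nonneg.2 (h 0 (by lia))))
  exact sub_nonneg.2 (h _ (Finset.mem_range.1 hk))

theorem discreteCaputo_neg (α τ : ℝ) (v : ℕ → ℝ) (n : ℕ) :
    discreteCaputo α τ (fun k => -v k) n = -discreteCaputo α τ v n := by
  rw [discreteCaputo, discreteCaputo, ← Finset.sum_neg_distrib]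
  exact Finset.sum_congr rfl fun _ _ => by ring

/-- The discrete fractional chain rule. -/
theorem history_succ_sub_le (hα0 : 0 < α) (hα1 : α < 1) (hτ : 0 < τ) (v : ℕ → ℝ) (m : ℕ) :
    history α τ v (m + 1) - history α τ v m
      ≤ 2 * discreteCaputo α τ v (m + 1) * (v (m + 1) - v m) := by
  -- `R` carries the weights of level `m + 1` but the value `v m`, so the change of value and the
  -- change of weights are estimated separately.
  set R := ∑ k ∈ Finset.range m, (coeff α τ (m - (k + 1)) - coeff α τ (m - k)) *
    (v m - v (k + 1)) ^ 2 + coeff α τ m * (v m - v 0) ^ 2 with hR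
  have h1 : history α τ v (m + 1) ≤ 2 * discreteCaputo α τ v (m + 1) * (v (m + 1) - v m) + R := by
    rw [history_succ, discreteCaputo_succ, hR]
    have a : ∑ k ∈ Finset.range m, (coeff α τ (m - (k + 1)) - coeff α τ (m - k)) *
          (v (m + 1) - v (k + 1)) ^ 2
        ≤ 2 * (∑ k ∈ Finset.range m, (coeff α τ (m - (k + 1)) - coeff α τ (m - k)) *
          (v (m + 1) - v (k + 1))) * (v (m + 1) - v m)
          + ∑ k ∈ Finset.range m, (coeff α τ (m - (k + 1)) - coeff α τ (m - k)) *
            (v m - v (k + 1)) ^ 2 := by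
      rw [Finset.mul_sum, Finset.sum_mul, ← Finset.sum_add_distrib]
      refine Finset.sum_le_sum fun k hk => ?_
      -- From `a² - b² = 2 a (a - b) - (a - b)²` with `a = v (m + 1) - v (k + 1)`, `b = v m - v (k +
      -- 1)`; the last square is dropped.
      have := mul_nonneg (coeff_sub_nonneg hα0 hα1 hτ (Finset.mem_range.1 hk))
        (sq_nonneg (v (m + 1) - v m))
      linarith
    have b := mul_nonneg (coeff_pos hα1 hτ m).le (sq_nonneg (v (m + 1) - v m))
    linarith
  have h2 : R ≤ history α τ v m := by
    cases m with
    | zero => simp [hR, history]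
    | succ p =>
      rw [history_succ, hR, Finset.sum_range_succ, sub_self]
      have a : ∑ k ∈ Finset.range p, (coeff α τ (p + 1 - (k + 1)) - coeff α τ (p + 1 - k)) *
            (v (p + 1) - v (k + 1)) ^ 2
          ≤ ∑ k ∈ Finset.range p, (coeff α τ (p - (k + 1)) - coeff α τ (p - k)) *
            (v (p + 1) - v (k + 1)) ^ 2 := by
        refine Finset.sum_le_sum fun k hk => mul_le_mul_of_nonneg_right ?_ (sq_nonneg _)
        have := Finset.mem_range.1 hk
        have := coeff_convex hα0 hα1 hτ (p - (k + 1))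
        rw [show p - (k + 1) + 1 = p - k by lia, show p - (k + 1) + 2 = p + 1 - k by lia] at this
        rwa [Nat.add_sub_add_right]
      have b := mul_le_mul_of_nonneg_right (coeff_succ_le hα0 hα1 hτ p)
        (sq_nonneg (v (p + 1) - v 0))
      linarith
  linarith

end

/-! ### The nonlinearity -/

/-- Taylor's formula with `F'' ≤ 2` on `[-1, 1]`; explicitly the gap is `(t - s)² (6 - 3 s² - 2 s t
- t²) / 4`. -/
theorem F_sub_le {s t : ℝ} (hs : |s| ≤ 1) (ht : |t| ≤ 1) :
    F t - F s ≤ f s * (t - s) + (t - s) ^ 2 := by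
  rw [abs_le] at hs ht
  have h : 0 ≤ 6 - 3 * s ^ 2 - 2 * s * t - t ^ 2 := by nlinarith
  have := mul_nonneg (sq_nonneg (t - s)) h
  unfold F f
  linarith

/-- The expression is `(f s + 2 (1 - s)) + (S - 2) (1 - s) + S (t - 1)`, and the first bracket
equals `(1 - s)² (2 + s)`. Here the full strength of `S ≥ 2` enters. -/
theorem f_add_mul_pos {S s t : ℝ} (hS : 2 ≤ S) (hs : |s| ≤ 1) (ht : 1 < t) :
    0 < f s + S * (t - s) := by
  rw [abs_le] at hs
  have h1 : 0 ≤ (1 - s) * (2 - s * (1 + s)) := mul_nonneg (by linarith) (by nlinarith)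
  have h2 : 0 ≤ (S - 2) * (1 - s) := mul_nonneg (by linarith) (by linarith)
  have h3 : 0 < S * (t - 1) := mul_pos (by linarith) (by linarith)
  unfold f
  linarith

theorem f_neg (s : ℝ) : f (-s) = -f s := by unfold f; ring

/-! ### Energy dissipation -/

section

variable {d : ℕ} {Ω : Set (E d)} {bc : BoundaryCondition d} {α γ ε S τ : ℝ} {N : ℕ}
  {u : ℕ → E d → ℝ} {G : ℕ → E d → E d}

/-- Solutions of the scheme inherit the bound `|u| ≤ 1` from the initial datum. -/
theorem IsSolution.ae_abs_le_one (hΩ : IsOpen Ω) [IsFiniteMeasure (volume.restrict Ω)]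
    (hα0 : 0 < α) (hα1 : α < 1) (hγ : 0 < γ) (hε : 0 < ε) (hS : 2 ≤ S) (hτ : 0 < τ)
    (hu : IsSolution Ω bc α γ ε S τ N u G)
    (hu0 : ∀ᵐ x ∂(volume.restrict Ω), |u 0 x| ≤ 1) {n : ℕ} (hn : n ≤ N) :
    ∀ᵐ x ∂(volume.restrict Ω), |u n x| ≤ 1 := by
  induction n using Nat.strong_induction_on with
  | _ n ih =>
    rcases n with _ | m
    · exact hu0
    have hprev : ∀ᵐ x ∂(volume.restrict Ω), ∀ k ≤ m, |u k x| ≤ 1 := by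
      refine ae_all_iff.2 fun k => ?_
      by_cases hk : k ≤ m
      · filter_upwards [ih k (by lia) (by lia)] with x hx _ using hx
      · exact .of_forall fun x h => absurd h hk
    obtain ⟨w, hL, hs⟩ := hu.scheme (m + 1) (by lia) hn
    have hε2 : 0 < ε ^ 2 := by positivity
    refine hL.ae_abs_le_one hΩ (hu.space _ hn) ?_ ?_
    · filter_upwards [hprev, hs] with x hp hs h1
      have hD : 0 ≤ discreteCaputo α τ (fun k => u k x) (m + 1) :=
        discreteCaputo_nonneg hα0 hα1 hτ fun k hk => ((abs_le.1 (hp k hk)).2.trans_lt h1).le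
      have hf := f_add_mul_pos hS (hp m le_rfl) h1
      rw [hs, Nat.add_sub_cancel] at hD
      have := nonneg_of_mul_nonneg_right hD hγ
      exact pos_of_mul_pos_right (by linarith : 0 < ε ^ 2 * w x) hε2.le
    -- The lower bound is the upper one for `-u`, as `f` is odd and the discrete derivative linear.
    · filter_upwards [hprev, hs] with x hp hs h1
      have hD : 0 ≤ discreteCaputo α τ (fun k => -u k x) (m + 1) :=
        discreteCaputo_nonneg hα0 hα1 hτ fun k hk =>
          neg_le_neg (h1.trans_le (abs_le.1 (hp k hk)).1).le
      have hf := f_add_mul_pos hS ((abs_neg _).trans_le (hp m le_rfl)) (lt_neg.1 h1)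
      rw [f_neg] at hf
      rw [discreteCaputo_neg, hs, Nat.add_sub_cancel, ← mul_neg] at hD
      have := nonneg_of_mul_nonneg_right hD hγ
      exact neg_of_mul_neg_right (by linarith : ε ^ 2 * w x < 0) hε2.le

theorem integrable_energyDensity [IsFiniteMeasure (volume.restrict Ω)] {v : E d → ℝ}
    {H : E d → E d} (h : IsH1 Ω v H) (hv : ∀ᵐ x ∂(volume.restrict Ω), |v x| ≤ 1) :
    IntegrableOn (energyDensity ε v H) Ω := by
  have cF : Continuous F := by unfold F; fun_prop
  refine (h.memLp_grad.norm.integrable_sq.const_mul _).add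
    (Integrable.of_bound (cF.comp_aestronglyMeasurable h.memLp.1) (1 / 4) ?_)
  filter_upwards [hv] with x hx
  have h1 := (sq_le_one_iff_abs_le_one _).2 hx
  have h2 := sq_nonneg (v x)
  rw [F, Real.norm_of_nonneg (by positivity)]
  nlinarith

theorem integrable_history (hm : ∀ n ≤ N, MemLp (u n) 2 (volume.restrict Ω)) {n : ℕ}
    (hn : n ≤ N) :
    Integrable (fun x => history α τ (fun k => u k x) n) (volume.restrict Ω) := by
  refine Integrable.add (integrable_finsetSum _ fun k hk => ?_)
    (((hm n hn).sub (hm 0 (by lia))).integrable_sq.const_mul _)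
  have := (Finset.mem_Icc.1 hk).2
  exact ((hm n hn).sub (hm k (by lia))).integrable_sq.const_mul _

theorem modifiedEnergy_eq (hm : ∀ n ≤ N, MemLp (u n) 2 (volume.restrict Ω)) {n : ℕ}
    (hn : n ≤ N) : modifiedEnergy Ω α γ ε τ u G n
      = energy Ω ε (u n) (G n) + 1 / (2 * γ) * ∫ x in Ω, history α τ (fun k => u k x) n := by
  have hi : ∀ k ≤ N, ∀ c : ℝ, Integrable (fun x => c * (u n x - u k x) ^ 2) (volume.restrict Ω) :=
    fun k hk c => ((hm n hn).sub (hm k hk)).integrable_sq.const_mul c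
  have hk : ∀ k ∈ Finset.Icc 1 (n - 1), k ≤ N := fun k hk => by
    have := (Finset.mem_Icc.1 hk).2
    lia
  unfold modifiedEnergy history normSq
  rw [integral_add (integrable_finsetSum _ fun k h => hi k (hk k h) _) (hi 0 (by lia) _),
    integral_finsetSum _ fun k h => hi k (hk k h) _]
  simp_rw [integral_const_mul]
  ring

theorem IsSolution.modifiedEnergy_succ_le [IsFiniteMeasure (volume.restrict Ω)]
    (hα0 : 0 < α) (hα1 : α < 1) (hγ : 0 < γ) (hS : 2 ≤ S) (hτ : 0 < τ)
    (hu : IsSolution Ω bc α γ ε S τ N u G)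
    (hb : ∀ n ≤ N, ∀ᵐ x ∂(volume.restrict Ω), |u n x| ≤ 1) {m : ℕ} (hn : m + 1 ≤ N) :
    modifiedEnergy Ω α γ ε τ u G (m + 1) ≤ modifiedEnergy Ω α γ ε τ u G m := by
  have hm : ∀ n ≤ N, MemLp (u n) 2 (volume.restrict Ω) := fun n hn => (hu.space n hn).isH1.memLp
  have hG : ∀ n ≤ N, MemLp (G n) 2 (volume.restrict Ω) := fun n hn =>
    (hu.space n hn).isH1.memLp_grad
  have hm' : m ≤ N := by lia
  obtain ⟨w, hL, hs⟩ := hu.scheme (m + 1) (by lia) hn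
  have hgreen := hL.green _ _ ((hu.space _ hn).sub (hu.space m hm'))
  have hE := fun n hn => integrable_energyDensity (ε := ε) (hu.space n hn).isH1 (hb n hn)
  have hH := fun n hn => (integrable_history (α := α) (τ := τ) (n := n) hm hn).const_mul
    (1 / (2 * γ))
  have i1 : Integrable (fun x => inner ℝ (G (m + 1) x) (G (m + 1) x - G m x))
      (volume.restrict Ω) :=
    Integrable.mono' ((hG _ hn).norm.integrable_mul ((hG _ hn).sub (hG _ hm')).norm)
      ((hG _ hn).1.inner ((hG _ hn).1.sub (hG _ hm').1))
      (.of_forall fun x => norm_inner_le_norm _ _)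
  have i2 : Integrable (fun x => w x * (u (m + 1) x - u m x)) (volume.restrict Ω) :=
    hL.memLp.integrable_mul ((hm _ hn).sub (hm _ hm'))
  have i3 : Integrable (fun x => ε ^ 2 * (inner ℝ (G (m + 1) x) (G (m + 1) x - G m x)
      + w x * (u (m + 1) x - u m x))) (volume.restrict Ω) := (i1.add i2).const_mul _
  have i4 : ∀ n ≤ N, Integrable (fun x => energyDensity ε (u n) (G n) x
      + 1 / (2 * γ) * history α τ (fun k => u k x) n) (volume.restrict Ω) := fun n hn =>
    (hE n hn).add (hH n hn)
  rw [modifiedEnergy_eq hm hn, modifiedEnergy_eq hm hm', energy, energy,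
    ← integral_const_mul, ← integral_const_mul, ← integral_add (hE _ hn) (hH _ hn),
    ← integral_add (hE _ hm') (hH _ hm')]
  -- Green's formula for the increment makes this integral vanish. Adding it to the right-hand side
  -- reduces the claim to a pointwise inequality.
  have hz : ∫ x in Ω, ε ^ 2 * (inner ℝ (G (m + 1) x) (G (m + 1) x - G m x)
      + w x * (u (m + 1) x - u m x)) = 0 := by
    rw [integral_const_mul, integral_add i1 i2, hgreen, neg_add_cancel, mul_zero]
  rw [← add_zero (∫ x in Ω, energyDensity ε (u m) (G m) x + _), ← hz,
    ← integral_add (i4 _ hm') i3]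
  refine integral_mono_ae (i4 _ hn) ((i4 _ hm').add i3) ?_
  filter_upwards [hs, hb _ hn, hb _ hm'] with x hs h1 h0
  have hF := F_sub_le h0 h1
  have hh := history_succ_sub_le hα0 hα1 hτ (fun k => u k x) m
  rw [hs, Nat.add_sub_cancel] at hh
  have hh' := mul_le_mul_of_nonneg_left hh (by positivity : 0 ≤ 1 / (2 * γ))
  have e1 : ∀ A B : ℝ, 1 / (2 * γ) * (2 * (γ * A) * B) = A * B := fun A B => by field_simp
  rw [e1] at hh'
  have hi : ‖G (m + 1) x‖ ^ 2 - ‖G m x‖ ^ 2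
      ≤ 2 * inner ℝ (G (m + 1) x) (G (m + 1) x - G m x) := by
    have a := norm_sub_sq_real (G (m + 1) x) (G m x)
    have b := sq_nonneg ‖G (m + 1) x - G m x‖
    rw [inner_sub_right, real_inner_self_eq_norm_sq]
    linarith
  have hi' := mul_le_mul_of_nonneg_left hi (by positivity : 0 ≤ ε ^ 2 / 2)
  -- The stabilization contributes `-S` and the explicit treatment of `f` at most `+1` times the
  -- squared increment, so `S ≥ 1` suffices here.
  have hS' := mul_nonneg (by linarith : 0 ≤ S - 1) (sq_nonneg (u (m + 1) x - u m x))
  simp only [energyDensity]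
  linarith

end

end TFAC

theorem mainTheorem3 {d : ℕ} (hd : 1 ≤ d) (Ω : Set (TFAC.E d)) (hΩ_open : IsOpen Ω)
    (hΩ_bdd : Bornology.IsBounded Ω) (hΩ_ne : Ω.Nonempty)
    (bc : TFAC.BoundaryCondition d) (hbc : bc.IsCompatible Ω)
    (α γ ε S T : ℝ) (hα0 : 0 < α) (hα1 : α < 1) (hγ : 0 < γ) (hε : 0 < ε) (hS : 2 ≤ S)
    (hT : 0 < T) (N : ℕ) (hN : 1 ≤ N)
    (u : ℕ → TFAC.E d → ℝ) (G : ℕ → TFAC.E d → TFAC.E d)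
    (hu : TFAC.IsSolution Ω bc α γ ε S (T / N) N u G)
    (hu0 : eLpNorm (u 0) ⊤ (volume.restrict Ω) ≤ 1) :
    (∀ n ≤ N, IntegrableOn (TFAC.energyDensity ε (u n) (G n)) Ω) ∧
    (∀ n, 1 ≤ n → n ≤ N →
      TFAC.modifiedEnergy Ω α γ ε (T / N) u G n
        ≤ TFAC.modifiedEnergy Ω α γ ε (T / N) u G (n - 1)) ∧
    (∀ n ≤ N, TFAC.energy Ω ε (u n) (G n) ≤ TFAC.energy Ω ε (u 0) (G 0)) := by
  have : IsFiniteMeasure (volume.restrict Ω) :=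
    isFiniteMeasure_restrict.2 hΩ_bdd.measure_lt_top.ne
  have hτ : 0 < T / N := by positivity
  have hinit : ∀ᵐ x ∂(volume.restrict Ω), |u 0 x| ≤ 1 := by
    rw [eLpNorm_exponent_top] at hu0
    filter_upwards [ae_le_eLpNormEssSup (f := u 0) (μ := volume.restrict Ω)] with x hx
    have h := hx.trans hu0
    rwa [← ofReal_norm, ENNReal.ofReal_le_one] at h
  have hb := fun n (hn : n ≤ N) =>
    hu.ae_abs_le_one hΩ_open hα0 hα1 hγ hε hS hτ hinit hn
  have hm := fun n (hn : n ≤ N) => (hu.space n hn).isH1.memLp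
  have hstep : ∀ n, 1 ≤ n → n ≤ N → TFAC.modifiedEnergy Ω α γ ε (T / N) u G n
      ≤ TFAC.modifiedEnergy Ω α γ ε (T / N) u G (n - 1) := fun n h1 hn => by
    obtain ⟨m, rfl⟩ := Nat.exists_eq_add_of_le' h1
    exact hu.modifiedEnergy_succ_le hα0 hα1 hγ hS hτ hb hn
  refine ⟨fun n hn => TFAC.integrable_energyDensity (hu.space n hn).isH1 (hb n hn), hstep, ?_⟩
  have hmono : ∀ n ≤ N, TFAC.modifiedEnergy Ω α γ ε (T / N) u G n
      ≤ TFAC.modifiedEnergy Ω α γ ε (T / N) u G 0 := fun n => by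
    induction n with
    | zero => exact fun _ => le_rfl
    | succ n ih => exact fun hn => (hstep (n + 1) (by lia) hn).trans (ih (by lia))
  intro n hn
  have h := hmono n hn
  rw [TFAC.modifiedEnergy_eq hm hn, TFAC.modifiedEnergy_eq hm (Nat.zero_le N)] at h
  -- At `n = 0` truncated subtraction leaves an empty sum and the term with `v 0 - v 0`.
  have h0 : ∫ x in Ω, TFAC.history α (T / N) (fun k => u k x) 0 = 0 := by simp [TFAC.history]
  have hn0 : 0 ≤ 1 / (2 * γ) * ∫ x in Ω, TFAC.history α (T / N) (fun k => u k x) n :=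
    mul_nonneg (by positivity) (integral_nonneg fun x => TFAC.history_nonneg hα0 hα1 hτ _ n)
  rw [h0, mul_zero, add_zero] at h
  linarith
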